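/- Let $\mathbb{F}_q$ be a finite field, $A=\mathbb{F}_q[\theta]$, $K_\infty=\mathbb{F}_q((1/\theta))$, and let $\mathbb{C}_\infty$ be the completion of an algebraic closure of $K_\infty$, with absolute value normalized by $|\theta|=q$. Let $\mathbb{T}_s$ be the Tate algebra of power series $\sum_\nu a_\nu \underline{t}^\nu\in\mathbb{C}_\infty[[t_1,\dots,t_s]]$ with $|a_\nu|\to 0$, with the Gauss norm $\|\cdot\|$, the twisting automorphism $\tau(\sum a_\nu\underline{t}^\nu)=\sum a_\nu^q\underline{t}^\nu$ and $f^{(n)}=\tau^n(f)$ for $n\in\mathbb{Z}$. Let $\mathbb{T}_s\{z/\theta\}$ be the ring of power series $\sum_i a_iz^i\in\mathbb{T}_s[[z]]$ with $|\theta|^i\|a_i\|\to0$; twisting acts on power series in $z$ coefficientwise. Let $\phi\colon A[t_1,\dots,t_s]\to\mathbb{T}_s[\tau]$ be a Drinfeld $A[t_1,\dots,t_s]$-module of rank $r\geqslant 1$, that is, a homomorphism of $\mathbb{F}_q[t_1,\dots,t_s]$-algebras into the twisted polynomial ring (with $\tau f=f^{(1)}\tau$) such that $$\phi_\theta=\theta+A_1\tau+\cdots+A_r\tau^r,\qquad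 A_i\in\mathbb{T}_s,$$ and assume that $A_r\in\mathbb{T}_s^\times$. Let $\exp_\phi=\sum_{i\geqslant0}\alpha_i\tau^i\in\mathbb{T}_s[[\tau]]$ be its exponential series, the unique series with $\alpha_0=1$ and $\exp_\phi a=\phi_a\exp_\phi$ for all $a\in A[t_1,\dots,t_s]$. Let $H(\phi)=\mathbb{T}_s[\sigma]$, $\sigma=\tau^{-1}$, be the Frobenius module of $\phi$, on which $\mathbb{T}_s[z]$ acts by $cz\cdot h=ch\,(\theta+A_1^{(-1)}\sigma+\cdots+A_r^{(-r)}\sigma^r)$. Let $\iota\colon\mathbb{T}_s[z]^r\to H(\phi)$ be the map $(h_1,\dots,h_r)\mapsto\sum_j h_j\cdot\sigma^{j-1}$ given by the $\mathbb{T}_s[z]$-basis $1,\sigma,\dots,\sigma^{r-1}$ of $H(\phi)$, and let $$\Phi=\begin{pmatrix}0&1&\cdots&0\\ \vdots&\vdots&\ddots&\vdots\\ 0&0&\cdots&1\\ \dfrac{z-\theta}{A_r^{(-r)}}&-\dfrac{A_1^{(-1)}}{A_r^{(-r)}}&\cdots&-\dfrac{A_{r-1}^{(-r+1)}}{A_r^{(-r)}}\end{pmatrix}\in\mathrm{Mat}_r(\mathbb{T}_s[z])$$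 be the matrix that represents multiplication by $\sigma$ with respect to this basis. A rigid analytic trivialization of $\phi$ is a triple $(\iota,\Phi,\Psi)$ with these $\iota$ and $\Phi$ and with a matrix $\Psi\in\mathrm{GL}_r(\mathbb{T}_s\{z/\theta\})$ such that $\Psi^{(-1)}=\Phi\Psi$. If $\phi$ has a rigid analytic trivialization $(\iota,\Phi,\Psi)$, then $\phi$ is uniformizable: the series $\exp_\phi(f)=\sum_{i\geqslant0}\alpha_i f^{(i)}$ converges for every $f\in\mathbb{T}_s$, and the function $\exp_\phi\colon\mathbb{T}_s\to\mathbb{T}_s$ is surjective. -/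

import Mathlib

open Filter Topology
open scoped NNReal WithZero

noncomputable section

namespace DrinfeldTate

/-! ### The fields `K_∞` and `ℂ_∞` -/

section Field

variable (Fq : Type*) [Field Fq] [Fintype Fq]

lemma one_lt_card : (1 : ℝ≥0) < Fintype.card Fq := by
  exact_mod_cast Fintype.one_lt_card

lemma card_ne_zero' : (Fintype.card Fq : ℝ≥0) ≠ 0 := (one_lt_card Fq).ne_bot

open Classical in
/-- The `∞`-adic absolute value on `K = Fq(θ)`, normalized so that `|θ| = q`. -/
def absInfty : AbsoluteValue (RatFunc Fq) ℝ where
  toFun f := WithZeroMulInt.toNNReal (card_ne_zero' Fq) (RatFunc.inftyValuation Fq f)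
  map_mul' f g := by simp
  nonneg' f := NNReal.coe_nonneg _
  eq_zero' f := by simp
  add_le' f g := by
    have h1 := (RatFunc.inftyValuation Fq).map_add f g
    have hm := (WithZeroMulInt.toNNReal_strictMono (one_lt_card Fq)).monotone
    have h2 := hm h1
    rw [hm.map_max] at h2
    exact_mod_cast h2.trans (max_le_add_of_nonneg (by simp) (by simp))

open Classical in
lemma absInfty_apply (f : RatFunc Fq) : absInfty Fq f =
    WithZeroMulInt.toNNReal (card_ne_zero' Fq) (RatFunc.inftyValuation Fq f) := rfl

lemma absInfty_add_le_max (f g : RatFunc Fq) :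
    absInfty Fq (f + g) ≤ max (absInfty Fq f) (absInfty Fq g) := by
  classical
  have h1 := (RatFunc.inftyValuation Fq).map_add f g
  have hm := (WithZeroMulInt.toNNReal_strictMono (one_lt_card Fq)).monotone
  have h2 := hm h1
  rw [hm.map_max] at h2
  simp only [absInfty_apply]
  exact_mod_cast h2

lemma absInfty_X : absInfty Fq RatFunc.X = Fintype.card Fq := by
  classical
  rw [absInfty_apply, RatFunc.inftyValuation.X,
    WithZeroMulInt.toNNReal_neg_apply _ WithZero.exp_ne_zero]
  have : WithZero.unzero (WithZero.exp_ne_zero (a := (1 : ℤ))) = Multiplicative.ofAdd 1 := rfl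
  simp [this]

/-- `K_∞`: the completion of `K = Fq(θ)` at the infinite place. -/
abbrev KInfty : Type _ := (absInfty Fq).Completion

/-- The completion of an ultrametric normed field is ultrametric. -/
lemma isUltrametricDist_completion (L : Type*) [NormedField L] [IsUltrametricDist L] :
    IsUltrametricDist (UniformSpace.Completion L) := by
  refine IsUltrametricDist.isUltrametricDist_of_forall_norm_add_le_max_norm fun x y => ?_
  induction x, y using UniformSpace.Completion.induction_on₂ with
  | hp => exact isClosed_le (by fun_prop) (by fun_prop)
  | ih x y =>
    rw [← UniformSpace.Completion.coe_add]
    simpa only [UniformSpace.Completion.norm_coe] using IsUltrametricDist.norm_add_le_max x y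

instance : IsUltrametricDist (WithAbs (absInfty Fq)) :=
  IsUltrametricDist.isUltrametricDist_of_forall_norm_add_le_max_norm fun _ _ =>
    absInfty_add_le_max Fq _ _

instance : IsUltrametricDist (KInfty Fq) := isUltrametricDist_completion _

instance : NontriviallyNormedField (KInfty Fq) where
  non_trivial := ⟨((WithAbs.toAbs (absInfty Fq) RatFunc.X : WithAbs (absInfty Fq)) : KInfty Fq), by
    rw [UniformSpace.Completion.norm_coe]
    change 1 < absInfty Fq RatFunc.X
    rw [absInfty_X]
    exact_mod_cast Fintype.one_lt_card⟩

/-- An algebraic closure of `K_∞`, with the unique extension of the absolute value. -/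
abbrev KInftyBar : Type _ := AlgebraicClosure (KInfty Fq)

instance : NormedField (KInftyBar Fq) := spectralNorm.normedField (KInfty Fq) (KInftyBar Fq)

instance : NormedAlgebra (KInfty Fq) (KInftyBar Fq) := spectralNorm.normedAlgebra _ _

instance : IsUltrametricDist (KInftyBar Fq) :=
  IsUltrametricDist.isUltrametricDist_of_forall_norm_add_le_max_norm
    (isNonarchimedean_spectralNorm (K := KInfty Fq) (L := KInftyBar Fq))

/-- `ℂ_∞`: the completion of an algebraic closure of `K_∞`. -/
abbrev CInfty : Type _ := UniformSpace.Completion (KInftyBar Fq)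

instance : NormedField (CInfty Fq) := inferInstance

instance : NormedRing (CInfty Fq) := inferInstance

instance : CommRing (CInfty Fq) := inferInstance

instance : IsUltrametricDist (CInfty Fq) := isUltrametricDist_completion _

/-- The embedding `K = Fq(θ) → ℂ_∞`. -/
def ofK : RatFunc Fq →+* CInfty Fq :=
  (UniformSpace.Completion.coeRingHom (α := KInftyBar Fq)).comp
    ((algebraMap (KInfty Fq) (KInftyBar Fq)).comp
      ((UniformSpace.Completion.coeRingHom (α := WithAbs (absInfty Fq))).comp
        (WithAbs.equiv (absInfty Fq)).symm.toRingHom))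

lemma norm_ofK (f : RatFunc Fq) : ‖ofK Fq f‖ = absInfty Fq f := by
  change ‖((algebraMap (KInfty Fq) (KInftyBar Fq)
    ((WithAbs.toAbs (absInfty Fq) f : WithAbs (absInfty Fq)) : KInfty Fq) : KInftyBar Fq) :
      CInfty Fq)‖ = _
  rw [UniformSpace.Completion.norm_coe, norm_algebraMap', UniformSpace.Completion.norm_coe]
  rfl

/-- The embedding `A = Fq[θ] → ℂ_∞`. -/
def ofA : Polynomial Fq →+* CInfty Fq := (ofK Fq).comp (algebraMap (Polynomial Fq) (RatFunc Fq))

/-- The `q`-th power map of `ℂ_∞`, a ring endomorphism since `ℂ_∞` contains `Fq`. -/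
def frobHom : CInfty Fq →+* CInfty Fq :=
  letI : Algebra Fq (CInfty Fq) := ((ofA Fq).comp Polynomial.C).toAlgebra
  (FiniteField.frobeniusAlgHom Fq (CInfty Fq)).toRingHom

lemma frobHom_apply (x : CInfty Fq) : frobHom Fq x = x ^ Fintype.card Fq := by
  simp [frobHom]

lemma norm_frobHom (x : CInfty Fq) : ‖frobHom Fq x‖ = ‖x‖ ^ Fintype.card Fq := by
  rw [frobHom_apply, norm_pow]

lemma frobHom_surjective : Function.Surjective (frobHom Fq) := by
  have hq : Fintype.card Fq ≠ 0 := Fintype.card_ne_zero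
  have hd (x y : CInfty Fq) :
      dist (frobHom Fq x) (frobHom Fq y) = dist x y ^ Fintype.card Fq := by
    rw [dist_eq_norm, ← map_sub, norm_frobHom, dist_eq_norm]
  have hu : IsUniformInducing (frobHom Fq) := by
    rw [Metric.isUniformInducing_iff]
    refine ⟨Metric.uniformContinuous_iff.mpr fun ε hε => ⟨min ε 1, by positivity, ?_⟩,
      fun δ hδ => ⟨δ ^ Fintype.card Fq, by positivity, ?_⟩⟩
    · intro a b hab
      rw [hd]
      calc dist a b ^ Fintype.card Fq ≤ dist a b :=
            pow_le_of_le_one dist_nonneg (hab.le.trans (min_le_right _ _)) hq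
        _ < ε := hab.trans_le (min_le_left _ _)
    · intro a b hab
      rw [hd] at hab
      exact lt_of_pow_lt_pow_left₀ _ hδ.le hab
  have hc : IsClosed (Set.range (frobHom Fq)) := hu.isComplete_range.isClosed
  have hdense : Dense (Set.range (frobHom Fq)) := by
    refine (UniformSpace.Completion.denseRange_coe (α := KInftyBar Fq)).mono ?_
    rintro _ ⟨a, rfl⟩
    obtain ⟨b, hb⟩ := IsAlgClosed.exists_pow_nat_eq a (Nat.pos_of_ne_zero hq)
    refine ⟨(b : CInfty Fq), ?_⟩
    rw [frobHom_apply, ← hb]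
    exact (map_pow (UniformSpace.Completion.coeRingHom (α := KInftyBar Fq)) b _).symm
  rw [← Set.range_eq_univ, ← hc.closure_eq, hdense.closure_eq]

/-- The `q`-th power Frobenius automorphism of `ℂ_∞`. -/
def frob : CInfty Fq ≃+* CInfty Fq :=
  RingEquiv.ofBijective (frobHom Fq) ⟨(frobHom Fq).injective, frobHom_surjective Fq⟩

lemma frob_apply (x : CInfty Fq) : frob Fq x = x ^ Fintype.card Fq := frobHom_apply Fq x

lemma norm_frob (x : CInfty Fq) : ‖frob Fq x‖ = ‖x‖ ^ Fintype.card Fq := norm_frobHom Fq x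

lemma norm_frob_symm (x : CInfty Fq) : ‖(frob Fq).symm x‖ ^ Fintype.card Fq = ‖x‖ := by
  rw [← norm_frob, RingEquiv.apply_symm_apply]

end Field

/-! ### Tate algebras -/

section Tate

variable (Fq : Type*) [Field Fq] [Fintype Fq] (s : ℕ)

/-- The Tate algebra `𝕋_s`: power series in `t_1, …, t_s` over `ℂ_∞` whose coefficients tend
to zero. -/
abbrev Tate : Type _ :=
  MvPowerSeries.IsRestricted.subring (R := CInfty Fq) (fun _ : Fin s => (1 : ℝ))

variable {Fq s}

lemma isRestricted_one_iff {f : MvPowerSeries (Fin s) (CInfty Fq)} :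
    MvPowerSeries.IsRestricted (fun _ : Fin s => (1 : ℝ)) f ↔
      Tendsto (fun ν => ‖MvPowerSeries.coeff ν f‖) cofinite (𝓝 0) := by
  simp [MvPowerSeries.IsRestricted]

lemma Tate.tendsto_coeff (f : Tate Fq s) :
    Tendsto (fun ν => ‖MvPowerSeries.coeff ν f.1‖) cofinite (𝓝 0) :=
  isRestricted_one_iff.mp f.2

lemma Tate.hasGaussNorm (f : Tate Fq s) :
    MvPowerSeries.HasGaussNorm (fun x : CInfty Fq => ‖x‖) (fun _ : Fin s => (1 : ℝ)) f.1 := by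
  have h := (show MvPowerSeries.IsRestricted (fun _ : Fin s => (1 : ℝ)) f.1 from f.2)
  exact Tendsto.bddAbove_range_of_cofinite h

variable (Fq s)

/-- The Gauss norm `‖f‖ = sup_ν |a_ν|` on `𝕋_s`. -/
def gaussRingNorm : RingNorm (Tate Fq s) where
  toFun f := MvPowerSeries.gaussNorm (fun x : CInfty Fq => ‖x‖) (fun _ : Fin s => (1 : ℝ)) f.1
  map_zero' := MvPowerSeries.gaussNorm_zero _ _ norm_zero
  add_le' f g := by
    refine (MvPowerSeries.gaussNorm_add_le_max (fun x : CInfty Fq => ‖x‖) _ _ _ (fun _ => zero_le_one)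
      (fun _ => norm_nonneg _) IsUltrametricDist.norm_add_le_max f.hasGaussNorm
      g.hasGaussNorm).trans (max_le_add_of_nonneg ?_ ?_) <;>
    exact MvPowerSeries.gaussNorm_nonneg _ _ _ fun _ => norm_nonneg _
  neg' f := MvPowerSeries.gaussNorm_neg _ _ norm_neg f.1
  mul_le' f g := MvPowerSeries.gaussNorm_mul_le (fun x : CInfty Fq => ‖x‖) _ _ _ (fun _ => zero_le_one)
    (fun _ => norm_nonneg _) (fun _ _ => norm_mul_le _ _) IsUltrametricDist.norm_add_le_max
    norm_zero f.hasGaussNorm g.hasGaussNorm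
  eq_zero_of_map_eq_zero' f hf := Subtype.ext <|
    (MvPowerSeries.gaussNorm_eq_zero_iff _ _ _ norm_zero (fun _ => norm_nonneg _)
      (fun _ => norm_eq_zero.mp) (fun _ => one_pos) f.hasGaussNorm).mp hf

instance : NormedCommRing (Tate Fq s) where
  __ := RingNorm.toNormedRing (gaussRingNorm Fq s)
  mul_comm := mul_comm

instance : CommRing (Tate Fq s) := inferInstance

instance : NormedRing (Tate Fq s) := inferInstance

lemma Tate.norm_def (f : Tate Fq s) : ‖f‖ =
    MvPowerSeries.gaussNorm (fun x : CInfty Fq => ‖x‖) (fun _ : Fin s => (1 : ℝ)) f.1 := rfl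

instance : IsUltrametricDist (Tate Fq s) :=
  IsUltrametricDist.isUltrametricDist_of_forall_norm_add_le_max_norm fun f g =>
    MvPowerSeries.gaussNorm_add_le_max (fun x : CInfty Fq => ‖x‖) _ _ _ (fun _ => zero_le_one)
      (fun _ => norm_nonneg _) IsUltrametricDist.norm_add_le_max f.hasGaussNorm g.hasGaussNorm

/-- The Frobenius twist `τ(∑ a_ν t^ν) = ∑ a_ν^q t^ν`, an automorphism of `𝕋_s`.  Its integral
powers are the twists `f ↦ f^{(n)}`. -/
def tau : RingAut (Tate Fq s) where
  toFun f := ⟨MvPowerSeries.map (frob Fq).toRingHom f.1, by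
    refine isRestricted_one_iff.mpr ?_
    have h := f.tendsto_coeff.pow (Fintype.card Fq)
    rw [zero_pow Fintype.card_ne_zero] at h
    refine h.congr fun ν => ?_
    rw [MvPowerSeries.coeff_map]
    exact (norm_frob Fq _).symm⟩
  invFun f := ⟨MvPowerSeries.map (frob Fq).symm.toRingHom f.1, by
    refine isRestricted_one_iff.mpr ?_
    have h := f.tendsto_coeff.rpow_const (p := ((Fintype.card Fq : ℝ)⁻¹)) (Or.inr (by positivity))
    rw [Real.zero_rpow (by simp)] at h
    refine h.congr fun ν => ?_
    rw [MvPowerSeries.coeff_map, ← norm_frob_symm]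
    exact Real.pow_rpow_inv_natCast (norm_nonneg _) Fintype.card_ne_zero⟩
  left_inv f := by
    refine Subtype.ext (MvPowerSeries.ext fun ν => ?_)
    simp
  right_inv f := by
    refine Subtype.ext (MvPowerSeries.ext fun ν => ?_)
    simp
  map_mul' f g := Subtype.ext (map_mul _ f.1 g.1)
  map_add' f g := Subtype.ext (map_add _ f.1 g.1)

lemma coeff_tau (f : Tate Fq s) (ν : Fin s →₀ ℕ) :
    MvPowerSeries.coeff ν (tau Fq s f).1 = MvPowerSeries.coeff ν f.1 ^ Fintype.card Fq := by
  rw [← frob_apply]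
  exact MvPowerSeries.coeff_map _ _ _

/-- The constants `ℂ_∞ → 𝕋_s`. -/
def Tate.const : CInfty Fq →+* Tate Fq s :=
  (MvPowerSeries.C (σ := Fin s) (R := CInfty Fq)).codRestrict _
    fun a => MvPowerSeries.isRestricted_C _ a

/-- The variable `t_i` in `𝕋_s`. -/
def Tate.var (i : Fin s) : Tate Fq s :=
  ⟨MvPowerSeries.X i, MvPowerSeries.isRestricted_monomial _ _ _⟩

/-- The inclusion `A[t_1, …, t_s] → 𝕋_s`. -/
def ofAts : MvPolynomial (Fin s) (Polynomial Fq) →+* Tate Fq s :=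
  MvPolynomial.eval₂Hom ((Tate.const Fq s).comp (ofA Fq)) (Tate.var Fq s)

/-- The element `θ` of `A[t_1, …, t_s]`. -/
def thetaA : MvPolynomial (Fin s) (Polynomial Fq) := MvPolynomial.C Polynomial.X

/-- The element `θ` of `𝕋_s`. -/
def theta : Tate Fq s := ofAts Fq s (thetaA Fq s)

/-- The inclusion `Fq[t_1, …, t_s] → A[t_1, …, t_s]`. -/
def ofFqts : MvPolynomial (Fin s) Fq →+* MvPolynomial (Fin s) (Polynomial Fq) :=
  MvPolynomial.map Polynomial.C

variable {Fq s}

/-- The Tate algebra `𝕋_s{z/c}`: power series `∑ a_i z^i` over `𝕋_s` with `‖c‖^i ‖a_i‖ → 0`. -/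
abbrev TateZ (c : Tate Fq s) : Type _ := PowerSeries.IsRestricted.subring (R := Tate Fq s) ‖c‖

end Tate

/-! ### Twisted power series and twisted polynomials -/

/-- The twisted power series ring `R[[τ]]`, with `τ f = τ(f) τ` for `f ∈ R`. -/
def TwistedPowerSeries (R : Type*) [CommRing R] (_τ : RingAut R) : Type _ := ℕ → R

namespace TwistedPowerSeries

open Finset

variable {R : Type*} [CommRing R] {τ : RingAut R}

instance : AddCommGroup (TwistedPowerSeries R τ) := inferInstanceAs (AddCommGroup (ℕ → R))

/-- The coefficient of `τ^n`. -/
def coeff (n : ℕ) (f : TwistedPowerSeries R τ) : R := f n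

/-- The series `∑ a_i τ^i`. -/
def mk (τ : RingAut R) (a : ℕ → R) : TwistedPowerSeries R τ := a

@[ext] lemma ext {f g : TwistedPowerSeries R τ} (h : ∀ n, coeff n f = coeff n g) : f = g :=
  funext h

@[simp] lemma coeff_mk (n : ℕ) (a : ℕ → R) : coeff n (mk τ a) = a n := rfl

@[simp] lemma coeff_zero (n : ℕ) : coeff n (0 : TwistedPowerSeries R τ) = 0 := rfl

@[simp] lemma coeff_add (n : ℕ) (f g : TwistedPowerSeries R τ) :
    coeff n (f + g) = coeff n f + coeff n g := rfl

@[simp] lemma coeff_neg (n : ℕ) (f : TwistedPowerSeries R τ) :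
    coeff n (-f) = -coeff n f := rfl

instance : Mul (TwistedPowerSeries R τ) :=
  ⟨fun f g => mk τ fun n => ∑ p ∈ antidiagonal n, coeff p.1 f * (τ ^ p.1) (coeff p.2 g)⟩

instance : One (TwistedPowerSeries R τ) := ⟨mk τ fun n => if n = 0 then 1 else 0⟩

lemma coeff_mul (n : ℕ) (f g : TwistedPowerSeries R τ) :
    coeff n (f * g) = ∑ p ∈ antidiagonal n, coeff p.1 f * (τ ^ p.1) (coeff p.2 g) := rfl

lemma coeff_one (n : ℕ) : coeff n (1 : TwistedPowerSeries R τ) = if n = 0 then 1 else 0 := rfl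

instance : Ring (TwistedPowerSeries R τ) where
  __ := (inferInstance : AddCommGroup (TwistedPowerSeries R τ))
  left_distrib f g h := by
    ext n; simp only [coeff_mul, coeff_add, map_add, mul_add, sum_add_distrib]
  right_distrib f g h := by
    ext n; simp only [coeff_mul, coeff_add, add_mul, sum_add_distrib]
  zero_mul f := by ext n; simp [coeff_mul]
  mul_zero f := by ext n; simp [coeff_mul]
  one_mul f := by
    ext n
    rw [coeff_mul, sum_eq_single (0, n)]
    · simp [coeff_one]
    · rintro ⟨i, j⟩ hij hne
      have : i ≠ 0 := by rintro rfl; simp_all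
      simp [coeff_one, this]
    · simp
  mul_one f := by
    ext n
    rw [coeff_mul, sum_eq_single (n, 0)]
    · simp [coeff_one]
    · rintro ⟨i, j⟩ hij hne
      have : j ≠ 0 := by rintro rfl; simp_all
      simp [coeff_one, this]
    · simp
  mul_assoc f g h := by
    ext n
    simp only [coeff_mul, sum_mul, map_sum, mul_sum]
    rw [sum_sigma', sum_sigma']
    refine sum_nbij' (fun ⟨⟨_, j⟩, ⟨k, l⟩⟩ => ⟨(k, l + j), (l, j)⟩)
      (fun ⟨⟨i, _⟩, ⟨k, l⟩⟩ => ⟨(i + k, l), (i, k)⟩) ?_ ?_ ?_ ?_ ?_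
    · rintro ⟨⟨i, j⟩, ⟨k, l⟩⟩ hm
      simp only [mem_sigma, HasAntidiagonal.mem_antidiagonal, and_true] at hm ⊢
      omega
    · rintro ⟨⟨i, j⟩, ⟨k, l⟩⟩ hm
      simp only [mem_sigma, HasAntidiagonal.mem_antidiagonal, and_true] at hm ⊢
      omega
    · rintro ⟨⟨i, j⟩, ⟨k, l⟩⟩ hm
      simp at hm ⊢
      grind
    · rintro ⟨⟨i, j⟩, ⟨k, l⟩⟩ hm
      simp at hm ⊢
      grind
    · rintro ⟨⟨i, j⟩, ⟨k, l⟩⟩ hm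
      simp only [mem_sigma, HasAntidiagonal.mem_antidiagonal] at hm
      simp only [← hm.2, map_mul, pow_add, RingAut.mul_apply, mul_assoc]

/-- The constants `R → R[[τ]]`. -/
def C (τ : RingAut R) : R →+* TwistedPowerSeries R τ where
  toFun a := mk τ fun n => if n = 0 then a else 0
  map_zero' := by ext n; simp
  map_one' := rfl
  map_add' a b := by ext n; by_cases h : n = 0 <;> simp [h]
  map_mul' a b := by
    ext n
    rw [coeff_mul]
    by_cases h : n = 0
    · subst h; simp
    · rw [sum_eq_zero]
      · simp [h]
      · rintro ⟨i, j⟩ hij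
        by_cases hi : i = 0
        · have : j ≠ 0 := by rintro rfl; simp_all
          simp [this]
        · simp [hi]

lemma coeff_C (n : ℕ) (a : R) : coeff n (C τ a) = if n = 0 then a else 0 := rfl

lemma coeff_C_mul (n : ℕ) (a : R) (f : TwistedPowerSeries R τ) :
    coeff n (C τ a * f) = a * coeff n f := by
  rw [coeff_mul, sum_eq_single (0, n)]
  · simp [coeff_C]
  · rintro ⟨i, j⟩ hij hne
    have : i ≠ 0 := by rintro rfl; simp_all
    simp [coeff_C, this]
  · simp

lemma coeff_mul_C (n : ℕ) (a : R) (f : TwistedPowerSeries R τ) :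
    coeff n (f * C τ a) = coeff n f * (τ ^ n) a := by
  rw [coeff_mul, sum_eq_single (n, 0)]
  · simp [coeff_C]
  · rintro ⟨i, j⟩ hij hne
    have : j ≠ 0 := by rintro rfl; simp_all
    simp [coeff_C, this]
  · simp

variable (R τ) in
/-- The twisted polynomial ring `R[τ]`: the series with finitely many nonzero coefficients. -/
def polynomials : Subring (TwistedPowerSeries R τ) where
  carrier := {f | ∃ d, ∀ n, d < n → coeff n f = 0}
  zero_mem' := ⟨0, fun _ _ => rfl⟩
  one_mem' := ⟨0, fun n hn => by simp [coeff_one, hn.ne']⟩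
  add_mem' := by
    rintro f g ⟨d, hd⟩ ⟨e, he⟩
    exact ⟨max d e, fun n hn => by
      simp [hd n ((le_max_left _ _).trans_lt hn), he n ((le_max_right _ _).trans_lt hn)]⟩
  neg_mem' := by
    rintro f ⟨d, hd⟩
    exact ⟨d, fun n hn => by simp [hd n hn]⟩
  mul_mem' := by
    rintro f g ⟨d, hd⟩ ⟨e, he⟩
    refine ⟨d + e, fun n hn => ?_⟩
    rw [coeff_mul, sum_eq_zero]
    rintro ⟨i, j⟩ hij
    rw [HasAntidiagonal.mem_antidiagonal] at hij
    dsimp only at hij ⊢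
    rcases lt_or_ge d i with h | h
    · simp [hd i h]
    · simp [he j (by omega)]

end TwistedPowerSeries

/-- The twisted polynomial ring `R[τ]`. -/
abbrev TwistedPolynomial (R : Type*) [CommRing R] (τ : RingAut R) : Type _ :=
  TwistedPowerSeries.polynomials R τ

namespace TwistedPolynomial

variable {R : Type*} [CommRing R] {τ : RingAut R}

/-- The coefficient of `τ^n`. -/
def coeff (n : ℕ) (f : TwistedPolynomial R τ) : R := TwistedPowerSeries.coeff n f.1

/-- The constants `R → R[τ]`. -/
def C (τ : RingAut R) : R →+* TwistedPolynomial R τ :=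
  (TwistedPowerSeries.C τ).codRestrict _
    fun a => ⟨0, fun n hn => by simp [TwistedPowerSeries.coeff_C, hn.ne']⟩

/-- The variable of `R[τ]`. -/
def X (τ : RingAut R) : TwistedPolynomial R τ :=
  ⟨TwistedPowerSeries.mk τ fun n => if n = 1 then 1 else 0,
    ⟨1, fun n hn => by simp [hn.ne']⟩⟩

/-- The anti-homomorphism `* : R[τ] → R[σ]`, `σ = τ⁻¹`,
`(∑ f_i τ^i)^* = ∑ f_i^{(-i)} σ^i`. -/
def adjoint (f : TwistedPolynomial R τ) : TwistedPolynomial R τ⁻¹ :=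
  ⟨TwistedPowerSeries.mk τ⁻¹ fun i => (τ ^ (-(i : ℤ))) (coeff i f), by
    obtain ⟨d, hd⟩ := f.2
    exact ⟨d, fun n hn => by simp [coeff, hd n hn]⟩⟩

end TwistedPolynomial

/-! ### Drinfeld modules over Tate algebras -/

/-- A Drinfeld `A[t_1, …, t_s]`-module of rank `r ≥ 1` over `𝕋_s`: a homomorphism of
`Fq[t_1, …, t_s]`-algebras `φ : A[t_1, …, t_s] → 𝕋_s[τ]`, `a ↦ φ_a`, such that
`φ_θ = θ + A_1 τ + ⋯ + A_r τ^r` with `A_r ≠ 0`. -/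
structure DrinfeldModule (Fq : Type*) [Field Fq] [Fintype Fq] (s r : ℕ) where
  /-- the ring homomorphism `a ↦ φ_a` -/
  toHom : MvPolynomial (Fin s) (Polynomial Fq) →+* TwistedPolynomial (Tate Fq s) (tau Fq s)
  map_const : ∀ c : MvPolynomial (Fin s) Fq,
    toHom (ofFqts Fq s c) = TwistedPolynomial.C _ (ofAts Fq s (ofFqts Fq s c))
  rank_pos : 1 ≤ r
  coeff_zero : (toHom (thetaA Fq s)).coeff 0 = theta Fq s
  coeff_rank : (toHom (thetaA Fq s)).coeff r ≠ 0
  coeff_of_lt : ∀ k, r < k → (toHom (thetaA Fq s)).coeff k = 0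

namespace DrinfeldModule

variable {Fq : Type*} [Field Fq] [Fintype Fq] {s r : ℕ} (φ : DrinfeldModule Fq s r)

/-- The coefficient `A_k` of `φ_θ = θ + A_1 τ + ⋯ + A_r τ^r`. -/
def A (k : ℕ) : Tate Fq s := (φ.toHom (thetaA Fq s)).coeff k

/-- A twisted power series `e` is an exponential series of `φ` if it has constant term `1` and
`e a = φ_a e` for all `a ∈ A[t_1, …, t_s]`. -/
def IsExponential (e : TwistedPowerSeries (Tate Fq s) (tau Fq s)) : Prop :=
  e.coeff 0 = 1 ∧ ∀ a, e * TwistedPowerSeries.C _ (ofAts Fq s a) = (φ.toHom a).1 * e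

lemma tau_const (x : CInfty Fq) :
    tau Fq s (Tate.const Fq s x) = Tate.const Fq s (x ^ Fintype.card Fq) := by
  refine Subtype.ext ?_
  change MvPowerSeries.map _ (MvPowerSeries.C x) = MvPowerSeries.C _
  rw [MvPowerSeries.map_C, ← frob_apply]
  rfl

lemma tau_var (i : Fin s) : tau Fq s (Tate.var Fq s i) = Tate.var Fq s i :=
  Subtype.ext (MvPowerSeries.map_X _ _)

lemma tau_ofFqts (c : MvPolynomial (Fin s) Fq) :
    tau Fq s (ofAts Fq s (ofFqts Fq s c)) = ofAts Fq s (ofFqts Fq s c) := by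
  induction c using MvPolynomial.induction_on with
  | C a =>
    simp [ofAts, ofFqts, tau_const, ← map_pow, FiniteField.pow_card]
  | add p q hp hq => simp only [map_add, hp, hq]
  | mul_X p i hp =>
    simp only [map_mul, hp]
    congr 1
    simp [ofAts, ofFqts, tau_var]

lemma theta_eq : theta Fq s = Tate.const Fq s (ofK Fq RatFunc.X) := by
  simp [theta, ofAts, thetaA, ofA]

lemma tau_pow_theta (n : ℕ) : (tau Fq s ^ n) (theta Fq s) =
    Tate.const Fq s (ofK Fq RatFunc.X ^ (Fintype.card Fq ^ n)) := by
  induction n with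
  | zero => simp [theta_eq]
  | succ n ih => rw [pow_succ', RingAut.mul_apply, ih, tau_const, ← pow_mul, ← pow_succ]

/-- `[n] = θ^{q^n} - θ` is a unit of `𝕋_s` for `n ≥ 1`. -/
lemma isUnit_bracket {n : ℕ} (hn : n ≠ 0) :
    IsUnit ((tau Fq s ^ n) (theta Fq s) - theta Fq s) := by
  rw [tau_pow_theta, theta_eq, ← map_sub]
  refine (IsUnit.mk0 _ fun h => ?_).map _
  have h1 : ‖ofK Fq RatFunc.X‖ = Fintype.card Fq := by rw [norm_ofK, absInfty_X]
  have h2 := congrArg norm (sub_eq_zero.mp h)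
  have h3 : (1 : ℝ) < Fintype.card Fq := by exact_mod_cast Fintype.one_lt_card
  rw [norm_pow, h1] at h2
  have h4 := (pow_right_injective₀ (by positivity) h3.ne') (h2.trans (pow_one _).symm)
  exact (Nat.one_lt_pow hn Fintype.one_lt_card).ne' h4

/-- The recursion for the coefficients of the exponential series. -/
def expAux : ℕ → Tate Fq s
  | 0 => 1
  | n + 1 => Ring.inverse ((tau Fq s ^ (n + 1)) (theta Fq s) - theta Fq s) *
      ∑ i : Fin (n + 1), φ.A (n + 1 - i) * (tau Fq s ^ (n + 1 - (i : ℕ))) (expAux i)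

lemma coeff_phi_mul (e : TwistedPowerSeries (Tate Fq s) (tau Fq s)) (n : ℕ) :
    ((φ.toHom (thetaA Fq s)).1 * e).coeff n = theta Fq s * e.coeff n +
      ∑ i : Fin n, φ.A (n - i) * (tau Fq s ^ (n - (i : ℕ))) (e.coeff i) := by
  have h0 : TwistedPowerSeries.coeff 0 (φ.toHom (thetaA Fq s)).1 = theta Fq s := φ.coeff_zero
  rw [TwistedPowerSeries.coeff_mul, Finset.Nat.sum_antidiagonal_eq_sum_range_succ
    (f := fun i j => TwistedPowerSeries.coeff i (φ.toHom (thetaA Fq s)).1 *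
      (tau Fq s ^ i) (TwistedPowerSeries.coeff j e)), ← Finset.sum_range_reflect,
    Finset.sum_range_succ, add_comm]
  congr 1
  · simp [h0]
  · rw [Finset.sum_range]
    refine Finset.sum_congr rfl fun i _ => ?_
    have hi := i.2
    rw [show n + 1 - 1 - (i : ℕ) = n - i by omega, show n - (n - (i : ℕ)) = i by omega]
    rfl

theorem existsUnique_exponential : ∃! e, φ.IsExponential e := by
  have hθ (e : TwistedPowerSeries (Tate Fq s) (tau Fq s)) (n : ℕ) :
      (e * TwistedPowerSeries.C _ (theta Fq s)).coeff n = ((φ.toHom (thetaA Fq s)).1 * e).coeff n ↔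
      ((tau Fq s ^ n) (theta Fq s) - theta Fq s) * e.coeff n =
        ∑ i : Fin n, φ.A (n - i) * (tau Fq s ^ (n - (i : ℕ))) (e.coeff i) := by
    rw [coeff_phi_mul, TwistedPowerSeries.coeff_mul_C, sub_mul, sub_eq_iff_eq_add',
      mul_comm (TwistedPowerSeries.coeff n e)]
  refine ⟨TwistedPowerSeries.mk _ φ.expAux, ⟨by simp [expAux], fun a => ?_⟩, fun e he => ?_⟩
  · set e := TwistedPowerSeries.mk (tau Fq s) φ.expAux with he
    have hconst (c : MvPolynomial (Fin s) Fq) :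
        e * TwistedPowerSeries.C _ (ofAts Fq s (ofFqts Fq s c)) =
          (φ.toHom (ofFqts Fq s c)).1 * e := by
      rw [φ.map_const]
      refine TwistedPowerSeries.ext fun n => ?_
      change _ = TwistedPowerSeries.coeff n (TwistedPowerSeries.C (tau Fq s) _ * e)
      rw [TwistedPowerSeries.coeff_mul_C, TwistedPowerSeries.coeff_C_mul, mul_comm]
      congr 1
      induction n with
      | zero => simp
      | succ n ih => rw [pow_succ, RingAut.mul_apply, tau_ofFqts, ih]
    have htheta : e * TwistedPowerSeries.C _ (ofAts Fq s (thetaA Fq s)) =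
        (φ.toHom (thetaA Fq s)).1 * e := by
      refine TwistedPowerSeries.ext fun n => ?_
      refine (hθ e n).mpr ?_
      cases n with
      | zero => simp
      | succ n =>
        rw [show TwistedPowerSeries.coeff (n + 1) e = φ.expAux (n + 1) from rfl, expAux,
          ← mul_assoc, Ring.mul_inverse_cancel _ (isUnit_bracket n.succ_ne_zero), one_mul]
        rfl
    have hadd (a b) (ha : e * TwistedPowerSeries.C _ (ofAts Fq s a) = (φ.toHom a).1 * e)
        (hb : e * TwistedPowerSeries.C _ (ofAts Fq s b) = (φ.toHom b).1 * e) :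
        e * TwistedPowerSeries.C _ (ofAts Fq s (a + b)) = (φ.toHom (a + b)).1 * e := by
      rw [map_add, map_add, mul_add, ha, hb, map_add, Subring.coe_add, add_mul]
    have hmul (a b) (ha : e * TwistedPowerSeries.C _ (ofAts Fq s a) = (φ.toHom a).1 * e)
        (hb : e * TwistedPowerSeries.C _ (ofAts Fq s b) = (φ.toHom b).1 * e) :
        e * TwistedPowerSeries.C _ (ofAts Fq s (a * b)) = (φ.toHom (a * b)).1 * e := by
      rw [map_mul, map_mul, ← mul_assoc, ha, mul_assoc, hb, map_mul, Subring.coe_mul, mul_assoc]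
    induction a using MvPolynomial.induction_on with
    | C a =>
      induction a using Polynomial.induction_on with
      | C c => simpa [ofFqts] using hconst (MvPolynomial.C c)
      | add p q hp hq => rw [map_add]; exact hadd _ _ hp hq
      | monomial n c h =>
        rw [pow_succ, ← mul_assoc, map_mul MvPolynomial.C]
        exact hmul _ _ h htheta
    | add p q hp hq => exact hadd _ _ hp hq
    | mul_X p i hp =>
      refine hmul _ _ hp ?_
      simpa [ofFqts] using hconst (MvPolynomial.X i)
  · refine TwistedPowerSeries.ext fun n => ?_
    induction n using Nat.strong_induction_on with
    | _ n ih =>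
      cases n with
      | zero => rw [he.1]; simp [expAux]
      | succ n =>
        have h := (hθ e (n + 1)).mp (congrArg (TwistedPowerSeries.coeff (n + 1))
          (he.2 (thetaA Fq s)))
        refine (isUnit_bracket (Fq := Fq) (s := s) n.succ_ne_zero).mul_left_cancel ?_
        rw [h, TwistedPowerSeries.coeff_mk, expAux, ← mul_assoc,
          Ring.mul_inverse_cancel _ (isUnit_bracket n.succ_ne_zero), one_mul]
        exact Finset.sum_congr rfl fun i _ => by rw [ih i i.2]; rfl

/-- The exponential series `exp_φ = ∑ α_i τ^i` of `φ`. -/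
def expSeries : TwistedPowerSeries (Tate Fq s) (tau Fq s) := φ.existsUnique_exponential.choose

theorem isExponential_expSeries : φ.IsExponential φ.expSeries :=
  φ.existsUnique_exponential.choose_spec.1

/-- The terms `α_i f^{(i)}` of the series that defines `exp_φ(f)`. -/
def expTerm (f : Tate Fq s) (i : ℕ) : Tate Fq s := φ.expSeries.coeff i * (tau Fq s ^ i) f

/-- The exponential function `exp_φ(f) = ∑ α_i f^{(i)}` of `φ`. -/
def exp (f : Tate Fq s) : Tate Fq s := ∑' i, φ.expTerm f i

/-- `φ` is uniformizable if `exp_φ : 𝕋_s → 𝕋_s` is surjective. -/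
def Uniformizable : Prop := Function.Surjective φ.exp

/-! ### Frobenius modules and rigid analytic trivializations -/

/-- The Frobenius module `H(φ) = 𝕋_s[σ]`, `σ = τ⁻¹`. -/
abbrev FrobeniusModule (_φ : DrinfeldModule Fq s r) : Type _ :=
  TwistedPolynomial (Tate Fq s) (tau Fq s)⁻¹

/-- The action of `𝕋_s[z]` on `H(φ)`: `(∑ c_k z^k) · h = ∑ c_k h (φ_θ^*)^k`. -/
def zAction (c : Polynomial (Tate Fq s)) (h : φ.FrobeniusModule) : φ.FrobeniusModule :=
  c.sum fun k a => TwistedPolynomial.C _ a * h * (φ.toHom (thetaA Fq s)).adjoint ^ k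

/-- The map `ι(h_1, …, h_r) = h_1 · 1 + h_2 · σ + ⋯ + h_r · σ^{r-1}` from `𝕋_s[z]^r` to `H(φ)`
given by the `𝕋_s[z]`-basis `1, σ, …, σ^{r-1}` of `H(φ)`. -/
def frameMap (h : Fin r → Polynomial (Tate Fq s)) : φ.FrobeniusModule :=
  ∑ j, φ.zAction (h j) (TwistedPolynomial.X _ ^ (j : ℕ))

/-- The matrix `Φ` that represents multiplication by `σ` on `H(φ)` with respect to the basis
`1, σ, …, σ^{r-1}`: its first `r - 1` rows are the rows `2, …, r` of the identity matrix, and its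
last row is `((z - θ)/A_r^{(-r)}, -A_1^{(-1)}/A_r^{(-r)}, …, -A_{r-1}^{(-r+1)}/A_r^{(-r)})`.
It is meant for `A_r` a unit of `𝕋_s`. -/
def frameMatrix : Matrix (Fin r) (Fin r) (Polynomial (Tate Fq s)) := fun i j =>
  if (i : ℕ) + 1 < r then
    if (j : ℕ) = i + 1 then 1 else 0
  else
    Polynomial.C (Ring.inverse ((tau Fq s ^ (-(r : ℤ))) (φ.A r))) *
      if (j : ℕ) = 0 then Polynomial.X - Polynomial.C (theta Fq s)
      else -Polynomial.C ((tau Fq s ^ (-(j : ℤ))) (φ.A j))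

/-- A rigid analytic trivialization `(ι, Φ, Ψ)` of `φ`: the pair `(ι, Φ)` is the `z`-frame given by
the basis `1, σ, …, σ^{r-1}` of `H(φ)`, and `Ψ ∈ GL_r(𝕋_s{z/θ})` satisfies `Ψ^{(-1)} = Φ Ψ`, where
twisting acts on the coefficients of power series in `z`. -/
structure RigidAnalyticTrivialization where
  /-- the map `ι : 𝕋_s[z]^r → H(φ)` -/
  iota : (Fin r → Polynomial (Tate Fq s)) → φ.FrobeniusModule
  /-- the matrix `Φ` of multiplication by `σ` -/
  Phi : Matrix (Fin r) (Fin r) (Polynomial (Tate Fq s))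
  /-- the trivializing matrix `Ψ` -/
  Psi : Matrix.GeneralLinearGroup (Fin r) (TateZ (theta Fq s))
  iota_eq : iota = φ.frameMap
  Phi_eq : Phi = φ.frameMatrix
  twist_Psi : Psi.1.map (fun f => PowerSeries.map (tau Fq s)⁻¹.toRingHom f.1) =
    Phi.map (fun f => (f : PowerSeries (Tate Fq s))) * Psi.1.map (fun f => f.1)

end DrinfeldModule

end DrinfeldTate

end

noncomputable section

namespace DrinfeldTate

/-! ### Norms, twists and completeness of the Tate algebra -/

section Tate

variable {Fq : Type*} [Field Fq] [Fintype Fq] {s : ℕ}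

/-! Write `φ_θ(F) = ∑ A_j F^{(j)}`. Near zero `exp_φ` is a small perturbation of the identity, so
its image contains a ball (`exists_exp_eq_of_norm_le`). Moreover `exp_φ(θ g) = φ_θ(exp_φ(g))`
(`exp_theta_mul`). Hence `f` lies in the image as soon as it has a `θ`-division tower `F 0 = f`,
`φ_θ(F (n+1)) = F n` with `F n → 0`: a late member is `exp_φ(g)`, and multiplying `g` by powers of
`θ` leads back to `f`.

The trivialization produces such a tower. Put `v = (f, 0, …, 0)` and solve `W = W^{(-1)} Φ + v` over
`𝕋_s{z/θ}`. Since `Ψ^{(-1)} = Φ Ψ`, the substitution `Y = W Ψ` reduces this to `Y - Y^{(-1)} = v Ψ`,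
a family of Artin–Schreier equations for the coefficients in `ℂ_∞`, solvable with control of small
solutions (`exists_sub_tau_inv_eq`). The companion shape of `Φ` turns the `z`-coefficients of `W`
into the tower, and membership in `𝕋_s{z/θ}` makes it tend to zero (`exists_division_tower`).

Convergence of `exp_φ` rests on `|θ^{q^n} - θ| = q^{q^n}` in the recursion for the `α_n`
(`norm_coeff_expSeries_le`). -/

lemma Tate.norm_coeff_le (f : Tate Fq s) (ν : Fin s →₀ ℕ) :
    ‖MvPowerSeries.coeff ν f.1‖ ≤ ‖f‖ := by
  rw [Tate.norm_def]
  simpa using MvPowerSeries.le_gaussNorm _ _ _ f.hasGaussNorm ν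

lemma Tate.norm_le_iff {f : Tate Fq s} {C : ℝ} :
    ‖f‖ ≤ C ↔ ∀ ν, ‖MvPowerSeries.coeff ν f.1‖ ≤ C := by
  refine ⟨fun h ν => (f.norm_coeff_le ν).trans h, fun h => ?_⟩
  rw [Tate.norm_def]
  exact ciSup_le fun ν => by simpa using h ν

/-- The `q`-th power is monotone, so it commutes with the supremum over coefficients; the lower
bound is obtained after taking `q`-th roots. -/
lemma norm_tau (f : Tate Fq s) : ‖tau Fq s f‖ = ‖f‖ ^ Fintype.card Fq := by
  refine le_antisymm (Tate.norm_le_iff.mpr fun ν => ?_) ?_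
  · rw [coeff_tau, norm_pow]
    gcongr
    exact f.norm_coeff_le ν
  · have hb := Real.rpow_inv_natCast_pow (norm_nonneg (tau Fq s f)) (Fintype.card_ne_zero (α := Fq))
    rw [← hb]
    gcongr
    refine Tate.norm_le_iff.mpr fun ν => ?_
    refine le_of_pow_le_pow_left₀ (Fintype.card_ne_zero (α := Fq)) (by positivity) ?_
    rw [hb, ← norm_pow, ← coeff_tau]
    exact Tate.norm_coeff_le _ ν

lemma norm_tau_pow (n : ℕ) (f : Tate Fq s) :
    ‖(tau Fq s ^ n) f‖ = ‖f‖ ^ Fintype.card Fq ^ n := by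
  induction n with
  | zero => simp
  | succ n ih => rw [pow_succ', RingAut.mul_apply, norm_tau, ih, ← pow_mul, ← pow_succ]

lemma norm_tau_inv_pow_card (f : Tate Fq s) : ‖(tau Fq s)⁻¹ f‖ ^ Fintype.card Fq = ‖f‖ := by
  rw [← norm_tau, ← RingAut.mul_apply, mul_inv_cancel, RingAut.one_apply]

lemma continuous_tau_pow (n : ℕ) : Continuous (tau Fq s ^ n) := by
  refine continuous_of_continuousAt_zero (tau Fq s ^ n) ?_
  rw [ContinuousAt, map_zero, tendsto_zero_iff_norm_tendsto_zero]
  simp only [norm_tau_pow]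
  have h : Continuous fun f : Tate Fq s => ‖f‖ ^ Fintype.card Fq ^ n := by fun_prop
  simpa using h.tendsto 0

lemma tendsto_tau_inv {ι : Type*} {l : Filter ι} {f : ι → Tate Fq s} (hf : Tendsto f l (𝓝 0)) :
    Tendsto (fun i => (tau Fq s)⁻¹ (f i)) l (𝓝 0) := by
  rw [tendsto_zero_iff_norm_tendsto_zero] at hf ⊢
  have h := hf.rpow_const (p := ((Fintype.card Fq : ℝ)⁻¹)) (Or.inr (by positivity))
  rw [Real.zero_rpow (by simp)] at h
  refine h.congr fun i => ?_
  rw [← norm_tau_inv_pow_card]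
  exact Real.pow_rpow_inv_natCast (norm_nonneg _) Fintype.card_ne_zero

lemma Tate.norm_const_le (c : CInfty Fq) : ‖Tate.const Fq s c‖ ≤ ‖c‖ := by
  classical
  refine Tate.norm_le_iff.mpr fun ν => ?_
  change ‖MvPowerSeries.coeff ν (MvPowerSeries.C c)‖ ≤ _
  rw [MvPowerSeries.coeff_C]
  split_ifs <;> simp

/-- Coefficients converge uniformly in `ν`. The limit is restricted because it is uniformly close to
a single restricted series `u N`. -/
instance : CompleteSpace (Tate Fq s) := by
  refine Metric.complete_of_cauchySeq_tendsto fun u hu => ?_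
  have hd (m n : ℕ) (ν : Fin s →₀ ℕ) : dist (MvPowerSeries.coeff ν (u m).1)
      (MvPowerSeries.coeff ν (u n).1) ≤ dist (u m) (u n) := by
    rw [dist_eq_norm, dist_eq_norm, ← map_sub]
    exact Tate.norm_coeff_le (u m - u n) ν
  have hc (ν : Fin s →₀ ℕ) : ∃ a, Tendsto (fun n => MvPowerSeries.coeff ν (u n).1) atTop
      (𝓝 a) := by
    refine cauchySeq_tendsto_of_complete ?_
    rw [Metric.cauchySeq_iff] at hu ⊢
    intro ε hε
    obtain ⟨N, hN⟩ := hu ε hε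
    exact ⟨N, fun m hm n hn => (hd m n ν).trans_lt (hN m hm n hn)⟩
  choose a ha using hc
  obtain ⟨b, hab⟩ : ∃ b : MvPowerSeries (Fin s) (CInfty Fq), ∀ ν, MvPowerSeries.coeff ν b = a ν :=
    ⟨fun ν => a ν, fun _ => rfl⟩
  simp only [← hab] at ha
  have hb (ε : ℝ) (hε : 0 < ε) : ∃ N, ∀ n ≥ N, ∀ ν, dist (MvPowerSeries.coeff ν (u n).1)
      (MvPowerSeries.coeff ν b) ≤ ε := by
    obtain ⟨N, hN⟩ := Metric.cauchySeq_iff.mp hu ε hε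
    exact ⟨N, fun n hn ν => le_of_tendsto (tendsto_const_nhds.dist (ha ν))
      ((eventually_ge_atTop N).mono fun m hm => (hd n m ν).trans (hN n hn m hm).le)⟩
  have hr : MvPowerSeries.IsRestricted (fun _ : Fin s => (1 : ℝ))  b := by
    rw [isRestricted_one_iff, Metric.tendsto_nhds]
    intro ε hε
    obtain ⟨N, hN⟩ := hb (ε / 2) (half_pos hε)
    filter_upwards [Metric.tendsto_nhds.mp (u N).tendsto_coeff (ε / 2) (half_pos hε)] with ν hν
    have h1 := hN N le_rfl ν
    rw [dist_zero_right, norm_norm] at hν ⊢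
    rw [dist_comm, dist_eq_norm] at h1
    linarith [norm_le_norm_add_norm_sub' (MvPowerSeries.coeff ν b) (MvPowerSeries.coeff ν (u N).1)]
  refine ⟨⟨_, hr⟩, Metric.tendsto_atTop.mpr fun ε hε => ?_⟩
  obtain ⟨N, hN⟩ := hb (ε / 2) (half_pos hε)
  refine ⟨N, fun n hn => ?_⟩
  rw [dist_eq_norm]
  refine (Tate.norm_le_iff.mpr fun ν => ?_).trans_lt (half_lt_self hε)
  have h := hN n hn ν
  rwa [dist_eq_norm, ← map_sub] at h

lemma norm_sub_le_max {G : Type*} [SeminormedAddCommGroup G] [IsUltrametricDist G] (x y : G) :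
    ‖x - y‖ ≤ max ‖x‖ ‖y‖ := by
  rw [sub_eq_add_neg, ← norm_neg y]
  exact IsUltrametricDist.norm_add_le_max x (-y)

/-- An additive map with `‖E g‖ ≤ ‖g‖ / 2` near zero is a perturbation of the identity whose
sum with the identity is onto a neighbourhood of zero. -/
lemma exists_add_eq_of_norm_le_half {G : Type*} [NormedAddCommGroup G] [IsUltrametricDist G]
    [CompleteSpace G] (E : G →+ G) {ε : ℝ} (hE : ∀ g, ‖g‖ ≤ ε → ‖E g‖ ≤ ‖g‖ / 2) {f : G}
    (hf : ‖f‖ ≤ ε) : ∃ g, g + E g = f := by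
  have hs : IsComplete (Metric.closedBall (0 : G) ε) := Metric.isClosed_closedBall.isComplete
  -- A solution is a fixed point of `g ↦ f - E g`. The ultrametric inequality keeps this map inside
  -- the ball and, with additivity of `E`, makes it `1/2`-Lipschitz there.
  have hm : Set.MapsTo (fun g => f - E g) (Metric.closedBall (0 : G) ε)
      (Metric.closedBall (0 : G) ε) := by
    intro g hg
    rw [mem_closedBall_zero_iff] at hg ⊢
    refine (norm_sub_le_max _ _).trans (max_le hf ?_)
    linarith [hE g hg, norm_nonneg g]
  have hk : ContractingWith (1 / 2 : ℝ≥0) (hm.restrict _ _ _) := by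
    refine ⟨by rw [div_lt_one two_pos]; exact one_lt_two, LipschitzWith.of_dist_le_mul fun x y => ?_⟩
    have hx := x.2
    have hy := y.2
    rw [mem_closedBall_zero_iff] at hx hy
    rw [Subtype.dist_eq, Subtype.dist_eq, dist_eq_norm, dist_eq_norm']
    change ‖f - E x - (f - E y)‖ ≤ _
    rw [sub_sub_sub_cancel_left, ← map_sub]
    refine (hE _ ((norm_sub_le_max _ _).trans (max_le hy hx))).trans_eq ?_
    push_cast
    ring
  obtain ⟨g, -, hg, -⟩ := hk.exists_fixedPoint' hs hm (x := f) (by simpa using hf) (edist_ne_top _ _)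
  refine ⟨g, ?_⟩
  have : f - E g = g := hg
  rw [← eq_sub_iff_add_eq, this]

end Tate

/-! ### Artin–Schreier equations over `ℂ_∞` and the Tate algebra -/

section ArtinSchreier

variable {Fq : Type*} [Field Fq] [Fintype Fq] {s : ℕ}

/-- The series `-∑ d^{q^n}` converges, and Frobenius shifts it by one term. -/
lemma exists_pow_card_sub_eq_of_norm_lt_one {d : CInfty Fq} (hd : ‖d‖ < 1) :
    ∃ x : CInfty Fq, x ^ Fintype.card Fq - x = d ∧ ‖x‖ ≤ ‖d‖ := by
  set q := Fintype.card Fq with hq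
  have hq1 : 1 < q := Fintype.one_lt_card
  have hs : Summable fun n : ℕ => d ^ q ^ n := by
    refine NonarchimedeanAddGroup.summable_of_tendsto_cofinite_zero ?_
    rw [Nat.cofinite_eq_atTop]
    exact (tendsto_pow_atTop_nhds_zero_of_norm_lt_one hd).comp (tendsto_pow_atTop_atTop_of_one_lt hq1)
  refine ⟨-∑' n : ℕ, d ^ q ^ n, ?_, ?_⟩
  · have hc : Continuous (frobHom Fq) := by
      simp only [funext (frobHom_apply Fq), continuous_pow]
    have h1 := hs.hasSum.map (frobHom Fq) hc
    have h2 := (hasSum_nat_add_iff' 1).mpr hs.hasSum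
    have h3 : (frobHom Fq) (∑' n : ℕ, d ^ q ^ n) = ∑' n : ℕ, d ^ q ^ n - d := by
      refine h1.unique ?_
      simp only [Finset.sum_range_one, pow_zero, pow_one] at h2
      simpa only [Function.comp_def, frobHom_apply, ← hq, ← pow_mul, ← pow_succ] using h2
    rw [← frobHom_apply, map_neg, h3]
    ring
  · rw [norm_neg]
    refine IsUltrametricDist.norm_tsum_le_of_forall_le_of_nonneg (norm_nonneg _) fun n => ?_
    rw [norm_pow]
    exact pow_le_of_le_one (norm_nonneg _) hd.le (by positivity)

/-- For large `c`, the power `c^q` is approximated to within distance `< 1` by some `b` in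
`KInftyBar`. A root for `b` exists there, before completion, and the small-norm case corrects the
error. -/
lemma exists_pow_card_sub_eq (c : CInfty Fq) :
    ∃ x : CInfty Fq, x ^ Fintype.card Fq - x = c ^ Fintype.card Fq ∧ (‖c‖ < 1 → ‖x‖ ≤ ‖c‖) := by
  have hq1 : 1 < Fintype.card Fq := Fintype.one_lt_card
  by_cases hc : ‖c‖ < 1
  · have h : ‖c ^ Fintype.card Fq‖ ≤ ‖c‖ := by
      rw [norm_pow]
      exact pow_le_of_le_one (norm_nonneg _) hc.le (by positivity)
    obtain ⟨x, hx, hx'⟩ := exists_pow_card_sub_eq_of_norm_lt_one (h.trans_lt hc)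
    exact ⟨x, hx, fun _ => hx'.trans h⟩
  · obtain ⟨b, hb⟩ := Metric.denseRange_iff.mp
      (UniformSpace.Completion.denseRange_coe (α := KInftyBar Fq)) (c ^ Fintype.card Fq) 1 one_pos
    rw [dist_eq_norm] at hb
    obtain ⟨y, hy, -⟩ := exists_pow_card_sub_eq_of_norm_lt_one hb
    obtain ⟨x, hx⟩ := IsAlgClosed.exists_root
      (Polynomial.X ^ Fintype.card Fq - (Polynomial.X + Polynomial.C b))
      (by
        rw [Polynomial.degree_sub_eq_left_of_degree_lt] <;>
        rw [Polynomial.degree_X_pow]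
        · exact_mod_cast Fintype.card_ne_zero
        · rw [Polynomial.degree_X_add_C]
          exact_mod_cast hq1)
    simp only [Polynomial.IsRoot, Polynomial.eval_sub, Polynomial.eval_pow, Polynomial.eval_X,
      Polynomial.eval_add, Polynomial.eval_C] at hx
    have hx' := congrArg (UniformSpace.Completion.coeRingHom (α := KInftyBar Fq)) hx
    simp only [map_sub, map_add, map_pow, map_zero] at hx'
    refine ⟨UniformSpace.Completion.coeRingHom x + y, ?_, fun h => absurd h hc⟩
    rw [← frobHom_apply, map_add, frobHom_apply, frobHom_apply]
    change _ = c ^ Fintype.card Fq - UniformSpace.Completion.coeRingHom b at hy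
    linear_combination hx' + hy

/-- Applying `τ` gives `x^q - x = c_ν^q` for each coefficient. All but finitely many `c_ν` have norm
`< 1`, where the solution is no larger than `c_ν`; so the solutions tend to zero. -/
lemma exists_sub_tau_inv_eq (c : Tate Fq s) :
    ∃ y : Tate Fq s, y - (tau Fq s)⁻¹ y = c ∧ (‖c‖ < 1 → ‖y‖ ≤ ‖c‖) := by
  choose x hx hx' using exists_pow_card_sub_eq (Fq := Fq)
  refine ⟨⟨fun ν => x (MvPowerSeries.coeff ν c.1), ?_⟩, ?_, fun h => ?_⟩
  · refine isRestricted_one_iff.mpr ?_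
    refine squeeze_zero_norm' ?_ c.tendsto_coeff
    filter_upwards [c.tendsto_coeff.eventually_lt_const one_pos] with ν hν
    rw [norm_norm]
    exact hx' _ hν
  · refine (tau Fq s).injective ?_
    rw [map_sub, ← RingAut.mul_apply, mul_inv_cancel, RingAut.one_apply]
    refine Subtype.ext (MvPowerSeries.ext fun ν => ?_)
    rw [coeff_tau, ← hx, AddSubgroupClass.coe_sub, map_sub, coeff_tau]
    rfl
  · refine Tate.norm_le_iff.mpr fun ν => (hx' _ ?_).trans (c.norm_coeff_le ν)
    exact (c.norm_coeff_le ν).trans_lt h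

end ArtinSchreier

/-! ### The norm of `θ^{q^n} - θ` -/

section Bracket

variable {Fq : Type*} [Field Fq] [Fintype Fq] {s : ℕ}

lemma norm_one_le : ‖(1 : Tate Fq s)‖ ≤ 1 := by
  simpa using Tate.norm_const_le (s := s) (1 : CInfty Fq)

lemma norm_ofK_X : ‖ofK Fq RatFunc.X‖ = Fintype.card Fq := by rw [norm_ofK, absInfty_X]

lemma norm_X_pow_sub_X {n : ℕ} (hn : n ≠ 0) :
    ‖ofK Fq RatFunc.X ^ Fintype.card Fq ^ n - ofK Fq RatFunc.X‖ =
      (Fintype.card Fq : ℝ) ^ Fintype.card Fq ^ n := by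
  have h3 : (1 : ℝ) < Fintype.card Fq := by exact_mod_cast Fintype.one_lt_card
  have hlt : ‖-ofK Fq RatFunc.X‖ < ‖ofK Fq RatFunc.X ^ Fintype.card Fq ^ n‖ := by
    rw [norm_neg, norm_pow, norm_ofK_X]
    exact lt_self_pow₀ h3 (Nat.one_lt_pow hn Fintype.one_lt_card)
  rw [sub_eq_add_neg, IsUltrametricDist.norm_add_eq_max_of_norm_ne_norm hlt.ne', max_eq_left hlt.le,
    norm_pow, norm_ofK_X]

/-- The bracket is a nonzero constant, so submultiplicativity applied to its inverse suffices;
multiplicativity of the Gauss norm is not needed. -/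
lemma mul_norm_le_norm_bracket_mul {n : ℕ} (hn : n ≠ 0) (x : Tate Fq s) :
    (Fintype.card Fq : ℝ) ^ Fintype.card Fq ^ n * ‖x‖ ≤
      ‖((tau Fq s ^ n) (theta Fq s) - theta Fq s) * x‖ := by
  rw [DrinfeldModule.tau_pow_theta, DrinfeldModule.theta_eq, ← map_sub, ← norm_X_pow_sub_X hn]
  set c := ofK Fq RatFunc.X ^ Fintype.card Fq ^ n - ofK Fq RatFunc.X with hc
  have hpos : 0 < ‖c‖ := by
    rw [hc, norm_X_pow_sub_X hn]
    exact pow_pos (by exact_mod_cast Fintype.card_pos) _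
  have hx : x = Tate.const Fq s c⁻¹ * (Tate.const Fq s c * x) := by
    rw [← mul_assoc, ← map_mul, inv_mul_cancel₀ (norm_pos_iff.mp hpos), map_one, one_mul]
  calc ‖c‖ * ‖x‖ ≤ ‖c‖ * (‖c⁻¹‖ * ‖Tate.const Fq s c * x‖) := by
        gcongr
        nth_rewrite 1 [hx]
        refine (norm_mul_le _ _).trans ?_
        gcongr
        exact Tate.norm_const_le _
    _ = ‖Tate.const Fq s c * x‖ := by
        rw [norm_inv, ← mul_assoc, mul_inv_cancel₀ hpos.ne', one_mul]

end Bracket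

/-! ### The exponential: convergence, local surjectivity, functional equation -/

namespace DrinfeldModule

variable {Fq : Type*} [Field Fq] [Fintype Fq] {s r : ℕ} (φ : DrinfeldModule Fq s r)

/-- A bound for `1` and for the norms of the coefficients of `φ_θ`. -/
def coeffBound : ℝ := 1 + ∑ k ∈ Finset.range (r + 1), ‖φ.A k‖

lemma one_le_coeffBound : 1 ≤ φ.coeffBound := by
  have : 0 ≤ ∑ k ∈ Finset.range (r + 1), ‖φ.A k‖ := by positivity
  rw [coeffBound]
  linarith

lemma A_eq_zero {k : ℕ} (hk : r < k) : φ.A k = 0 := φ.coeff_of_lt k hk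

lemma A_zero : φ.A 0 = theta Fq s := φ.coeff_zero

lemma norm_A_le (k : ℕ) : ‖φ.A k‖ ≤ φ.coeffBound := by
  by_cases hk : r < k
  · rw [φ.A_eq_zero hk, norm_zero]
    linarith [φ.one_le_coeffBound]
  · have := Finset.single_le_sum (f := fun k => ‖φ.A k‖) (fun _ _ => norm_nonneg _)
      (Finset.mem_range.mpr (show k < r + 1 by omega))
    rw [coeffBound]
    linarith

lemma bracket_mul_coeff_expSeries (n : ℕ) :
    ((tau Fq s ^ n) (theta Fq s) - theta Fq s) * φ.expSeries.coeff n =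
      ∑ i : Fin n, φ.A (n - i) * (tau Fq s ^ (n - (i : ℕ))) (φ.expSeries.coeff i) := by
  have h := congrArg (TwistedPowerSeries.coeff n) (φ.isExponential_expSeries.2 (thetaA Fq s))
  rw [coeff_phi_mul, TwistedPowerSeries.coeff_mul_C] at h
  rw [sub_mul, sub_eq_iff_eq_add', ← h, mul_comm]
  rfl

/-- The parameter `l` serves two purposes: `l = 1` gives the bound used near zero, `l = q^{-1/r}`
gives convergence everywhere. In the recursion only the `r` preceding coefficients occur, and
division by the bracket gains `q^{q^n}`. -/
lemma norm_coeff_expSeries_le {l : ℝ} (hl0 : 0 ≤ l) (hl1 : l ≤ 1)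
    (hl : 1 ≤ l ^ r * Fintype.card Fq) (n : ℕ) :
    ‖φ.expSeries.coeff n‖ ≤
      φ.coeffBound ^ (Fintype.card Fq ^ n - 1) * (l ^ n) ^ Fintype.card Fq ^ n := by
  set q := Fintype.card Fq with hq
  set B := φ.coeffBound with hB
  have hB1 : 1 ≤ B := φ.one_le_coeffBound
  have hq1 : 1 < q := Fintype.one_lt_card
  induction n using Nat.strong_induction_on with
  | _ n ih =>
    rcases eq_or_ne n 0 with rfl | hn
    · rw [φ.isExponential_expSeries.1]
      simpa using norm_one_le
    have hqpos : (0 : ℝ) < (q : ℝ) ^ q ^ n := by positivity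
    refine le_of_mul_le_mul_left ?_ hqpos
    refine (mul_norm_le_norm_bracket_mul hn _).trans ?_
    rw [bracket_mul_coeff_expSeries]
    refine IsUltrametricDist.norm_sum_le_of_forall_le_of_nonneg (by positivity) fun i _ => ?_
    obtain ⟨i, hi⟩ := i
    dsimp only
    obtain ⟨j, rfl⟩ := Nat.exists_eq_add_of_lt hi
    rw [show i + j + 1 - i = j + 1 by omega]
    by_cases hj : r < j + 1
    · rw [φ.A_eq_zero hj, zero_mul, norm_zero]
      positivity
    have h1 : ‖φ.A (j + 1) * (tau Fq s ^ (j + 1)) (φ.expSeries.coeff i)‖ ≤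
        B * (B ^ (q ^ i - 1) * (l ^ i) ^ q ^ i) ^ q ^ (j + 1) := by
      refine (norm_mul_le _ _).trans ?_
      rw [norm_tau_pow]
      gcongr
      · exact φ.norm_A_le _
      · exact ih i (by omega)
    have h2 : B * (B ^ (q ^ i - 1) * (l ^ i) ^ q ^ i) ^ q ^ (j + 1) =
        B ^ (1 + (q ^ i - 1) * q ^ (j + 1)) * (l ^ i) ^ q ^ (i + j + 1) := by
      rw [mul_pow, ← pow_mul, ← pow_mul (l ^ i), ← pow_add, pow_add B, pow_one, mul_assoc,
        add_assoc]
    -- The product equals `q^{i+j+1} - q^{j+1}`, and `q^{j+1} ≥ 2` leaves room for the extra factor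
    -- `B` coming from `A_{j+1}`.
    have h3 : 1 + (q ^ i - 1) * q ^ (j + 1) ≤ q ^ (i + j + 1) - 1 := by
      have h5 : q ^ (i + j + 1) = q ^ i * q ^ (j + 1) := by rw [add_assoc, pow_add]
      have h6 : 1 < q ^ (j + 1) := Nat.one_lt_pow (by omega) hq1
      have h7 : 1 * q ^ (j + 1) ≤ q ^ i * q ^ (j + 1) :=
        Nat.mul_le_mul_right _ (Nat.one_le_pow _ _ (by omega))
      rw [h5, Nat.sub_mul]
      omega
    -- As `j + 1 ≤ r`, the factor `q` gained from the bracket pays for passing from `l^i` to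
    -- `l^{i+j+1}`.
    have h4 : l ^ i ≤ q * l ^ (i + j + 1) := by
      have h5 : l ^ r ≤ l ^ (j + 1) := pow_le_pow_of_le_one hl0 hl1 (by omega)
      have h6 : 1 ≤ l ^ (j + 1) * q := hl.trans (by gcongr)
      calc l ^ i = l ^ i * 1 := (mul_one _).symm
        _ ≤ l ^ i * (l ^ (j + 1) * q) := by gcongr
        _ = q * l ^ (i + j + 1) := by rw [add_assoc, pow_add]; ring
    refine h1.trans (h2.trans_le ?_)
    calc _ ≤ B ^ (q ^ (i + j + 1) - 1) * (q * l ^ (i + j + 1)) ^ q ^ (i + j + 1) := by gcongr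
      _ = _ := by rw [mul_pow]; ring

lemma norm_coeff_expSeries_le_pow (n : ℕ) :
    ‖φ.expSeries.coeff n‖ ≤ φ.coeffBound ^ (Fintype.card Fq ^ n - 1) := by
  have h : (1 : ℝ) ≤ Fintype.card Fq := by exact_mod_cast Fintype.card_pos
  simpa using φ.norm_coeff_expSeries_le zero_le_one le_rfl (by simpa using h) n

lemma norm_expTerm_le (f : Tate Fq s) (n : ℕ) :
    ‖φ.expTerm f n‖ ≤ ‖φ.expSeries.coeff n‖ * ‖f‖ ^ Fintype.card Fq ^ n :=
  (norm_mul_le _ _).trans_eq (by rw [norm_tau_pow])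

/-- With `B = φ.coeffBound`, the `n`-th term is at most `(B l^n ‖f‖)^{q^n}`, whose base tends to
zero when `l < 1`; in a complete ultrametric group, terms tending to zero are summable. -/
theorem summable_expTerm (f : Tate Fq s) : Summable (φ.expTerm f) := by
  have hq1 : (1 : ℝ) < Fintype.card Fq := by exact_mod_cast Fintype.one_lt_card
  have hr : r ≠ 0 := (Nat.one_le_iff_ne_zero.mp φ.rank_pos)
  -- `l = q^{-1/r}` is the least value that `norm_coeff_expSeries_le` admits.
  obtain ⟨l, hl0, hl⟩ : ∃ l : ℝ, 0 ≤ l ∧ l ^ r = (Fintype.card Fq : ℝ)⁻¹ :=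
    ⟨_, by positivity, Real.rpow_inv_natCast_pow (x := (Fintype.card Fq : ℝ)⁻¹) (by positivity) hr⟩
  have hl1 : l < 1 := by
    by_contra! h
    have := one_le_pow₀ h (n := r)
    rw [hl] at this
    linarith [inv_lt_one_of_one_lt₀ hq1]
  have hB := φ.one_le_coeffBound
  refine NonarchimedeanAddGroup.summable_of_tendsto_cofinite_zero ?_
  rw [Nat.cofinite_eq_atTop]
  have ht : Tendsto (fun n => φ.coeffBound * l ^ n * ‖f‖) atTop (𝓝 0) := by
    simpa using ((tendsto_pow_atTop_nhds_zero_of_lt_one hl0 hl1).const_mul φ.coeffBound).mul_const ‖f‖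
  refine squeeze_zero_norm' ?_ (tendsto_pow_atTop_nhds_zero_of_lt_one (r := (1 / 2 : ℝ))
    (by norm_num) (by norm_num))
  filter_upwards [ht.eventually_le_const (show (0 : ℝ) < 1 / 2 by norm_num)] with n hn
  calc ‖φ.expTerm f n‖
      ≤ φ.coeffBound ^ (Fintype.card Fq ^ n - 1) * (l ^ n) ^ Fintype.card Fq ^ n *
          ‖f‖ ^ Fintype.card Fq ^ n := by
        refine (φ.norm_expTerm_le f n).trans ?_
        gcongr
        exact φ.norm_coeff_expSeries_le hl0 hl1.le
          (by rw [hl, inv_mul_cancel₀ (by positivity)]) n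
    _ ≤ φ.coeffBound ^ (Fintype.card Fq ^ n) * (l ^ n) ^ Fintype.card Fq ^ n *
          ‖f‖ ^ Fintype.card Fq ^ n := by
        gcongr
        omega
    _ = (φ.coeffBound * l ^ n * ‖f‖) ^ Fintype.card Fq ^ n := by rw [mul_pow, mul_pow]
    _ ≤ (1 / 2) ^ Fintype.card Fq ^ n := by gcongr
    _ ≤ (1 / 2) ^ n := pow_le_pow_of_le_one (by norm_num) (by norm_num)
        (Nat.lt_pow_self Fintype.one_lt_card).le

lemma hasSum_exp (f : Tate Fq s) : HasSum (φ.expTerm f) (φ.exp f) := (φ.summable_expTerm f).hasSum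

lemma exp_add (f g : Tate Fq s) : φ.exp (f + g) = φ.exp f + φ.exp g := by
  refine (φ.hasSum_exp _).unique ?_
  convert (φ.hasSum_exp f).add (φ.hasSum_exp g) using 2 with n
  simp only [expTerm, map_add, mul_add]

/-- The radius makes `B ‖g‖ ≤ 1/2` for `B = φ.coeffBound`, and the term of index `n ≥ 1` is at most
`(B ‖g‖)^{q^n - 1} ‖g‖`. -/
lemma norm_exp_sub_self_le {g : Tate Fq s} (hg : ‖g‖ ≤ (2 * φ.coeffBound)⁻¹) :
    ‖φ.exp g - g‖ ≤ ‖g‖ / 2 := by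
  have hB := φ.one_le_coeffBound
  have hBg : φ.coeffBound * ‖g‖ ≤ 1 / 2 := by
    calc _ ≤ φ.coeffBound * (2 * φ.coeffBound)⁻¹ := by gcongr
      _ = 1 / 2 := by field_simp
  have h := (hasSum_nat_add_iff' 1).mpr (φ.hasSum_exp g)
  have h0 : φ.expTerm g 0 = g := by
    rw [expTerm, φ.isExponential_expSeries.1, pow_zero, RingAut.one_apply, one_mul]
  rw [Finset.sum_range_one, h0] at h
  rw [← h.tsum_eq]
  refine IsUltrametricDist.norm_tsum_le_of_forall_le_of_nonneg (by positivity) fun n => ?_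
  -- Since `q^{n+1} ≥ 2`, one factor `B ‖g‖ ≤ 1/2` can be split off; the other `m` are at most `1`.
  obtain ⟨m, hm⟩ : ∃ m, Fintype.card Fq ^ (n + 1) = m + 1 + 1 := by
    have := Nat.one_lt_pow (Nat.add_one_ne_zero n) (Fintype.one_lt_card (α := Fq))
    exact ⟨Fintype.card Fq ^ (n + 1) - 2, by omega⟩
  calc _ ≤ φ.coeffBound ^ (Fintype.card Fq ^ (n + 1) - 1) * ‖g‖ ^ Fintype.card Fq ^ (n + 1) := by
        refine (φ.norm_expTerm_le g _).trans ?_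
        gcongr
        exact φ.norm_coeff_expSeries_le_pow _
    _ = (φ.coeffBound * ‖g‖) ^ m * (φ.coeffBound * ‖g‖) * ‖g‖ := by
        rw [hm, Nat.add_sub_cancel]
        ring
    _ ≤ 1 * (1 / 2) * ‖g‖ := by
        gcongr
        exact pow_le_one₀ (by positivity) (by linarith)
    _ = ‖g‖ / 2 := by ring

lemma exists_exp_eq_of_norm_le {f : Tate Fq s} (hf : ‖f‖ ≤ (2 * φ.coeffBound)⁻¹) :
    ∃ g, φ.exp g = f := by
  obtain ⟨g, hg⟩ := exists_add_eq_of_norm_le_half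
    (AddMonoidHom.mk' (fun g => φ.exp g - g) fun a b => by rw [exp_add]; abel)
    (fun g hg => φ.norm_exp_sub_self_le hg) hf
  exact ⟨g, by rw [← hg]; simp⟩

/-- This is `exp_φ θ = φ_θ exp_φ` evaluated at `g`: the powers of `τ` are continuous, so they act
termwise on the convergent sum. -/
lemma exp_theta_mul (g : Tate Fq s) :
    φ.exp (theta Fq s * g) = ∑ j ∈ Finset.range (r + 1), φ.A j * (tau Fq s ^ j) (φ.exp g) := by
  -- Shifting by `j` and padding with zeros indexes every summand by the total exponent `n` of `τ`.
  have h1 (j : ℕ) : HasSum (fun n => if j ≤ n then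
      φ.A j * (tau Fq s ^ j) (φ.expSeries.coeff (n - j)) * (tau Fq s ^ n) g else 0)
      (φ.A j * (tau Fq s ^ j) (φ.exp g)) := by
    have h := ((φ.hasSum_exp g).map (tau Fq s ^ j) (continuous_tau_pow j)).mul_left (φ.A j)
    rw [← (add_left_injective j).hasSum_iff]
    · refine (congrArg (HasSum · _) (funext fun n => ?_)).mp h
      simp only [Function.comp_apply, expTerm, map_mul]
      rw [if_pos (Nat.le_add_left _ _), Nat.add_sub_cancel, mul_assoc, ← RingAut.mul_apply,
        ← pow_add, add_comm j n]
    · intro n hn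
      refine if_neg fun hjn => hn ⟨n - j, Nat.sub_add_cancel hjn⟩
  have h2 := hasSum_sum fun j (_ : j ∈ Finset.range (r + 1)) => h1 j
  refine (φ.hasSum_exp _).unique ?_
  convert h2 using 2 with n
  have h3 := congrArg (TwistedPowerSeries.coeff n) (φ.isExponential_expSeries.2 (thetaA Fq s))
  rw [TwistedPowerSeries.coeff_mul_C, TwistedPowerSeries.coeff_mul,
    Finset.Nat.sum_antidiagonal_eq_sum_range_succ_mk] at h3
  rw [expTerm, map_mul, ← mul_assoc]
  refine (congrArg (· * _) h3).trans ?_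
  rw [Finset.sum_mul]
  -- Both ranges are enlarged to `n + r + 1`: the condition kills `j > n`, and `A_j = 0` for `j >
  -- r`.
  calc _ = ∑ j ∈ Finset.range (n + 1), (if j ≤ n then φ.A j *
          (tau Fq s ^ j) (φ.expSeries.coeff (n - j)) * (tau Fq s ^ n) g else 0) :=
        Finset.sum_congr rfl fun j hj =>
          (if_pos (Nat.lt_succ_iff.mp (Finset.mem_range.mp hj))).symm
    _ = ∑ j ∈ Finset.range (n + r + 1), (if j ≤ n then φ.A j *
          (tau Fq s ^ j) (φ.expSeries.coeff (n - j)) * (tau Fq s ^ n) g else 0) :=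
        Finset.sum_subset (Finset.range_mono (by omega)) fun j _ hj =>
          if_neg fun h => hj (Finset.mem_range.mpr (by omega))
    _ = _ := by
        refine (Finset.sum_subset (Finset.range_mono (by omega)) fun j _ hj => ?_).symm
        rw [φ.A_eq_zero (by rw [Finset.mem_range] at hj; omega), zero_mul, zero_mul, ite_self]

end DrinfeldModule

/-! ### Artin–Schreier equations over `𝕋_s{z/θ}` -/

section TateZ

variable {Fq : Type*} [Field Fq] [Fintype Fq] {s : ℕ}

/-- The inverse twist of power series in `z`, coefficientwise. -/
def invTwist (Fq : Type*) [Field Fq] [Fintype Fq] (s : ℕ) :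
    PowerSeries (Tate Fq s) →+* PowerSeries (Tate Fq s) :=
  PowerSeries.map (tau Fq s)⁻¹.toRingHom

lemma coeff_invTwist (n : ℕ) (f : PowerSeries (Tate Fq s)) :
    PowerSeries.coeff n (invTwist Fq s f) = (tau Fq s)⁻¹ (PowerSeries.coeff n f) :=
  PowerSeries.coeff_map _ _ _

lemma one_le_norm_theta : 1 ≤ ‖theta Fq s‖ := by
  have h := (theta Fq s).norm_coeff_le 0
  have h' : MvPowerSeries.coeff 0 (theta Fq s).1 = ofK Fq RatFunc.X := by
    rw [DrinfeldModule.theta_eq]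
    exact MvPowerSeries.coeff_zero_C _
  rw [h', norm_ofK, absInfty_X] at h
  exact le_trans (by exact_mod_cast Fintype.card_pos) h

lemma TateZ.tendsto_norm_coeff (f : TateZ (theta Fq s)) :
    Tendsto (fun n => ‖PowerSeries.coeff n f.1‖ * ‖theta Fq s‖ ^ n) atTop (𝓝 0) :=
  (PowerSeries.isRestricted_iff' _ _).mp f.2

lemma TateZ.tendsto_coeff (f : TateZ (theta Fq s)) :
    Tendsto (fun n => PowerSeries.coeff n f.1) atTop (𝓝 0) := by
  refine squeeze_zero_norm (fun n => ?_) f.tendsto_norm_coeff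
  exact le_mul_of_one_le_right (norm_nonneg _) (one_le_pow₀ one_le_norm_theta)

/-- As `‖θ‖ ≥ 1`, the coefficients of `g` eventually have norm `< 1`; from there on the solutions
are no larger and inherit the weighted decay. -/
lemma exists_sub_invTwist_eq (g : TateZ (theta Fq s)) :
    ∃ y : TateZ (theta Fq s), y.1 - invTwist Fq s y.1 = g.1 := by
  choose y hy hy' using exists_sub_tau_inv_eq (Fq := Fq) (s := s)
  refine ⟨⟨PowerSeries.mk fun n => y (PowerSeries.coeff n g.1), ?_⟩, ?_⟩
  · refine (PowerSeries.isRestricted_iff' _ _).mpr ?_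
    refine squeeze_zero_norm' ?_ g.tendsto_norm_coeff
    have h := g.tendsto_coeff.norm
    rw [norm_zero] at h
    filter_upwards [h.eventually_lt_const one_pos] with n hn
    rw [PowerSeries.coeff_mk, norm_mul, norm_norm, norm_pow, norm_norm]
    gcongr
    exact hy' _ hn
  · ext n : 1
    rw [map_sub, coeff_invTwist, PowerSeries.coeff_mk, hy]

end TateZ

/-! ### From a trivialization to division towers and surjectivity -/

namespace DrinfeldModule

variable {Fq : Type*} [Field Fq] [Fintype Fq] {s r : ℕ}

/-- The first-order system attached to `φ` has a solution with coefficients tending to zero. -/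
lemma RigidAnalyticTrivialization.exists_eq_vecMul_add {φ : DrinfeldModule Fq s r}
    (T : φ.RigidAnalyticTrivialization) (f : Fin r → Tate Fq s) :
    ∃ w : Fin r → TateZ (theta Fq s), ∀ j, (w j).1 =
      ∑ i, invTwist Fq s (w i).1 * (φ.frameMatrix i j : PowerSeries (Tate Fq s)) +
        PowerSeries.C (f j) := by
  classical
  let C (a : Tate Fq s) : TateZ (theta Fq s) :=
    ⟨PowerSeries.C a, PowerSeries.isRestricted_C _ a⟩
  let ι : TateZ (theta Fq s) →+* PowerSeries (Tate Fq s) := Subring.subtype _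
  let Ψ : Matrix (Fin r) (Fin r) (PowerSeries (Tate Fq s)) := T.Psi.1.map ι
  let Ψ' : Matrix (Fin r) (Fin r) (PowerSeries (Tate Fq s)) := T.Psi.2.map ι
  let Φ : Matrix (Fin r) (Fin r) (PowerSeries (Tate Fq s)) :=
    φ.frameMatrix.map (fun f => (f : PowerSeries (Tate Fq s)))
  have hΨ : Ψ.map (invTwist Fq s) = Φ * Ψ := by
    have h := T.twist_Psi
    rw [T.Phi_eq] at h
    exact h
  have hinv : Ψ * Ψ' = 1 := by
    rw [← Matrix.map_mul, T.Psi.3, Matrix.map_one _ (map_zero ι) (map_one ι)]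
  -- The substitution `Y = W Ψ` uncouples the system into the scalar equations `Y - Y^{(-1)} = v Ψ`.
  choose y hy using fun j => exists_sub_invTwist_eq (Matrix.vecMul (fun j => C (f j)) T.Psi.1 j)
  let v : Fin r → PowerSeries (Tate Fq s) := fun j => PowerSeries.C (f j)
  let Y : Fin r → PowerSeries (Tate Fq s) := fun j => (y j).1
  have hY : Y = invTwist Fq s ∘ Y + Matrix.vecMul v Ψ := by
    funext j
    refine (sub_eq_iff_eq_add'.mp (hy j)).trans (congrArg _ ?_)
    exact RingHom.map_vecMul ι T.Psi.1 (fun j => C (f j)) j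
  refine ⟨Matrix.vecMul y T.Psi.2, ?_⟩
  let W : Fin r → PowerSeries (Tate Fq s) := Matrix.vecMul Y Ψ'
  have hW (j) : (Matrix.vecMul y T.Psi.2 j).1 = W j :=
    RingHom.map_vecMul ι T.Psi.2 y j
  have hinv' : Ψ' * Ψ = 1 := by
    rw [← Matrix.map_mul, T.Psi.4, Matrix.map_one _ (map_zero ι) (map_one ι)]
  have hWΨ : Matrix.vecMul W Ψ = Y := by
    rw [Matrix.vecMul_vecMul, hinv', Matrix.vecMul_one]
  have hWΨ' : Matrix.vecMul (invTwist Fq s ∘ W) (Ψ.map (invTwist Fq s)) = invTwist Fq s ∘ Y := by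
    funext j
    rw [← RingHom.map_vecMul, hWΨ, Function.comp_apply]
  -- `Ψ` is invertible, so it is enough to compare after right multiplication by it, where `Φ Ψ =
  -- Ψ^{(-1)}` applies.
  have key : W = Matrix.vecMul (invTwist Fq s ∘ W) Φ + v := by
    have h1 : Matrix.vecMul W Ψ = Matrix.vecMul (Matrix.vecMul (invTwist Fq s ∘ W) Φ + v) Ψ := by
      rw [Matrix.add_vecMul, Matrix.vecMul_vecMul (invTwist Fq s ∘ W), ← hΨ, hWΨ, hWΨ']
      exact hY
    have h2 := congrArg (fun u => Matrix.vecMul u Ψ') h1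
    simpa only [Matrix.vecMul_vecMul, hinv, Matrix.vecMul_one] using h2
  intro j
  have h := congrFun key j
  simp only [hW]
  exact h

/-- For every `f` there is a `θ`-division tower above `f` that tends to zero. -/
lemma RigidAnalyticTrivialization.exists_division_tower {φ : DrinfeldModule Fq s r}
    (T : φ.RigidAnalyticTrivialization) (hA : IsUnit (φ.A r)) (f : Tate Fq s) :
    ∃ F : ℕ → Tate Fq s, F 0 = f ∧ Tendsto F atTop (𝓝 0) ∧
      ∀ n, ∑ j ∈ Finset.range (r + 1), φ.A j * (tau Fq s ^ j) (F (n + 1)) = F n := by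
  obtain ⟨m, rfl⟩ : ∃ m, r = m + 1 := ⟨r - 1, by have := φ.rank_pos; omega⟩
  obtain ⟨w, hw⟩ := T.exists_eq_vecMul_add (Pi.single 0 f)
  set τ := tau Fq s
  let a : Tate Fq s := Ring.inverse ((τ ^ (-((m + 1 : ℕ) : ℤ))) (φ.A (m + 1)))
  let W (n : ℕ) (j : Fin (m + 1)) : Tate Fq s := PowerSeries.coeff n (w j).1
  -- `F n` is the `z^n`-coefficient of the common factor `P` through which the last row of `Φ`
  -- enters. `G` is the tower itself: `f` followed by the `F n`.
  let F (n : ℕ) : Tate Fq s := τ⁻¹ (W n (Fin.last m)) * a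
  let G (n : ℕ) : Tate Fq s := if n = 0 then f else F (n - 1)
  let P : PowerSeries (Tate Fq s) := invTwist Fq s (w (Fin.last m)).1 * PowerSeries.C a
  have hP (n : ℕ) : PowerSeries.coeff n P = F n := by
    rw [PowerSeries.coeff_mul_C, coeff_invTwist]
  -- In the first column of `Φ` only `(z - θ)/A_r^{(-r)}` is nonzero; `z` shifts the index, and `f`
  -- fills the gap at `n = 0`.
  have hzero (n : ℕ) : W n 0 = G n - theta Fq s * F n := by
    have h : (w 0).1 = P * (PowerSeries.X - PowerSeries.C (theta Fq s)) + PowerSeries.C f := by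
      rw [hw, Fin.sum_univ_castSucc, Finset.sum_eq_zero, zero_add, Pi.single_eq_same, mul_assoc]
      · simp [frameMatrix, a, τ]
      · intro i _
        simp [frameMatrix]
    have h' := congrArg (PowerSeries.coeff n) h
    rw [map_add, mul_sub, map_sub, PowerSeries.coeff_mul_C, hP] at h'
    refine h'.trans ?_
    cases n with
    | zero =>
      simp only [PowerSeries.coeff_zero_mul_X, PowerSeries.coeff_zero_C, G, if_true]
      ring
    | succ n =>
      rw [PowerSeries.coeff_succ_mul_X, hP, PowerSeries.coeff_C, if_neg n.succ_ne_zero]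
      simp only [G, if_neg n.succ_ne_zero, Nat.add_sub_cancel]
      ring
  have hsucc (n : ℕ) (j : Fin m) : W n j.succ =
      τ⁻¹ (W n j.castSucc) - F n * (τ ^ (-((j + 1 : ℕ) : ℤ))) (φ.A (j + 1)) := by
    have h : (w j.succ).1 = invTwist Fq s (w j.castSucc).1 -
        P * PowerSeries.C ((τ ^ (-((j + 1 : ℕ) : ℤ))) (φ.A (j + 1))) := by
      rw [hw, Fin.sum_univ_castSucc, Finset.sum_eq_single j, Pi.single_eq_of_ne j.succ_ne_zero,
        map_zero, add_zero, mul_assoc, sub_eq_add_neg]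
      · simp [frameMatrix, a, τ]
      · intro i _ hi
        have : (j : ℕ) ≠ i := fun h => hi (Fin.ext h.symm)
        simp [frameMatrix, this]
      · simp
    have h' := congrArg (PowerSeries.coeff n) h
    rw [map_sub, PowerSeries.coeff_mul_C, hP, coeff_invTwist] at h'
    exact h'
  have hcancel (k : ℕ) (x : Tate Fq s) : (τ ^ k) ((τ ^ (-(k : ℤ))) x) = x := by
    rw [zpow_neg, zpow_natCast, ← RingAut.mul_apply, mul_inv_cancel, RingAut.one_apply]
  have hcancel' (k : ℕ) (x : Tate Fq s) : (τ ^ (k + 1)) (τ⁻¹ x) = (τ ^ k) x := by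
    rw [← RingAut.mul_apply, pow_succ, mul_inv_cancel_right]
  have hlast (n : ℕ) : φ.A (m + 1) * (τ ^ (m + 1)) (F n) = (τ ^ m) (W n (Fin.last m)) := by
    have ha : (τ ^ (-((m + 1 : ℕ) : ℤ))) (φ.A (m + 1)) * a = 1 :=
      Ring.mul_inverse_cancel _ (hA.map _)
    have ha' := congrArg (τ ^ (m + 1)) ha
    rw [map_mul, hcancel, map_one] at ha'
    rw [map_mul, hcancel', mul_left_comm, ha', mul_one]
  -- Twisting the `j`-th relation by `τ^j` makes the relations telescope into partial sums of `φ_θ(F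
  -- n)`; `hlast` supplies the top term.
  have hsum (n : ℕ) (j : Fin (m + 1)) : (τ ^ (j : ℕ)) (W n j) =
      G n - ∑ k ∈ Finset.range (j + 1), φ.A k * (τ ^ k) (F n) := by
    induction j using Fin.induction with
    | zero => simp [hzero, φ.A_zero]
    | succ j ih =>
      rw [Fin.val_castSucc] at ih
      rw [hsucc, Fin.val_succ, Finset.sum_range_succ, ← sub_sub, ← ih, map_sub, hcancel', map_mul,
        hcancel, mul_comm]
  have hF : Tendsto F atTop (𝓝 0) := by
    have h := (tendsto_tau_inv (w (Fin.last m)).tendsto_coeff).mul_const a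
    rwa [zero_mul] at h
  refine ⟨G, rfl, ?_, fun n => ?_⟩
  · refine (tendsto_add_atTop_iff_nat 1).mp (hF.congr fun n => ?_)
    simp [G]
  · change ∑ j ∈ Finset.range (m + 1 + 1), φ.A j * (τ ^ j) (F n) = G n
    have h := hsum n (Fin.last m)
    rw [Fin.val_last] at h
    rw [Finset.sum_range_succ, hlast, h]
    abel

theorem RigidAnalyticTrivialization.uniformizable {φ : DrinfeldModule Fq s r}
    (T : φ.RigidAnalyticTrivialization) (hA : IsUnit (φ.A r)) : φ.Uniformizable := by
  intro f
  obtain ⟨F, rfl, hF, hdiv⟩ := T.exists_division_tower hA f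
  have hB := φ.one_le_coeffBound
  have hF' := hF.norm
  rw [norm_zero] at hF'
  obtain ⟨n, hn⟩ := (hF'.eventually_le_const
    (show 0 < (2 * φ.coeffBound)⁻¹ by positivity)).exists
  -- If `F (n+1) = exp_φ(g)`, then `F n = exp_φ(θ g)`.
  have hdesc (n : ℕ) (h : F n ∈ Set.range φ.exp) : F 0 ∈ Set.range φ.exp := by
    induction n with
    | zero => exact h
    | succ n ih =>
      obtain ⟨g, hg⟩ := h
      exact ih ⟨theta Fq s * g, by rw [exp_theta_mul, hg, hdiv]⟩
  exact hdesc n (φ.exists_exp_eq_of_norm_le hn)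

end DrinfeldModule

end DrinfeldTate

end

theorem theorem4 {Fq : Type*} [Field Fq] [Fintype Fq] {s r : ℕ}
    (φ : DrinfeldTate.DrinfeldModule Fq s r) (hA : IsUnit (φ.A r))
    (T : φ.RigidAnalyticTrivialization) :
    (∀ f, Summable (φ.expTerm f)) ∧ φ.Uniformizable :=
  ⟨φ.summable_expTerm, T.uniformizable hA⟩
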